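/- Let $\mathbb{T}=(T,\eta,\mu)$ be a monad on $\mathsf{Set}$ that is finitary ($T$ preserves directed colimits) and commutative (the two maps $TX\times TY\to T(X\times Y)$ obtained by composing, in the Kleisli category, the right and the left strength of $\mathbb{T}$ in either order agree for all sets $X,Y$). A $\mathbb{T}$-algebra $A$ is *finitely generated* if there is a surjective $\mathbb{T}$-morphism $\mathbb{T}G\twoheadrightarrow A$ from the free algebra on a finite set $G$, and *finitely presentable* if it is the coequalizer, in the category of $\mathbb{T}$-algebras, of some pair $p,q\colon \mathbb{T}X\to\mathbb{T}Y$ with $X,Y$ finite sets. A *$\mathbb{T}$-monoid* is a $\mathbb{T}$-algebra $(M,a)$ together with a monoid structure $(M,\cdot,e)$ such that for every $m\in M$ the maps $m\cdot(-)$ and $(-)\cdot m$ are $\mathbb{T}$-endomorphisms of $(M,a)$; morphisms of $\mathbb{T}$-monoids are $\mathbb{T}$-morphisms that are also monoid morphisms. A $\mathbb{T}$-monoid is *fg-carried* if its underlying $\mathbb{T}$-algebra is finitely generated, and *finitely presentable* if it is the coequalizer, in the category of $\mathbb{T}$-monoids, of a pair of morphisms between free $\mathbb{T}$-monoids on finite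 sets. **Theorem.** If $\mathbb{T}$ is finitary and commutative, and every finitely generated $\mathbb{T}$-algebra is finitely presentable, then every fg-carried $\mathbb{T}$-monoid is finitely presentable (as a $\mathbb{T}$-monoid). -/

import Mathlib

open CategoryTheory CategoryTheory.Limits

universe u

namespace MonadAlg

/-- A monad on sets is finitary if its underlying functor preserves directed colimits,
i.e. colimits of diagrams indexed by (nonempty) directed posets. -/
def IsFinitary (T : Monad (Type u)) : Prop :=
  ∀ (J : Type u) [PartialOrder J] [IsDirectedOrder J] [Nonempty J],
    PreservesColimitsOfShape J T.toFunctor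

/-- The left strength `X × TY → T(X × Y)`, `(x, t) ↦ T(y ↦ (x, y))(t)`. -/
def leftStrength (T : Monad (Type u)) (X Y : Type u) (p : X × T.obj Y) : T.obj (X × Y) :=
  T.map (TypeCat.ofHom fun y : Y => (p.1, y)) p.2

/-- The right strength `TX × Y → T(X × Y)`, `(s, y) ↦ T(x ↦ (x, y))(s)`. -/
def rightStrength (T : Monad (Type u)) (X Y : Type u) (p : T.obj X × Y) : T.obj (X × Y) :=
  T.map (TypeCat.ofHom fun x : X => (x, p.2)) p.1

/-- Composition `f ; Tg ; μ` of Kleisli morphisms `f : X → TY` and `g : Y → TZ`. -/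
def kleisliComp (T : Monad (Type u)) {X Y Z : Type u} (f : X → T.obj Y) (g : Y → T.obj Z) :
    X → T.obj Z :=
  fun x => T.μ.app Z (T.map (TypeCat.ofHom g) (f x))

/-- A monad on sets is commutative if the two ways `TX × TY → T(X × Y)` of combining the right
and the left strength by Kleisli composition agree. -/
def IsCommutative (T : Monad (Type u)) : Prop :=
  ∀ X Y : Type u,
    kleisliComp T (rightStrength T X (T.obj Y)) (leftStrength T X Y) =
      kleisliComp T (leftStrength T (T.obj X) Y) (rightStrength T X Y)

/-- A `T`-algebra is finitely generated if it is the image of a surjective `T`-morphism from the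
free `T`-algebra on a finite set. -/
def Algebra.IsFG {T : Monad (Type u)} (A : T.Algebra) : Prop :=
  ∃ (G : Type u) (_ : Finite G) (s : T.free.obj G ⟶ A), Function.Surjective s.f

/-- A `T`-algebra is finitely presentable if it is the coequalizer in the category of `T`-algebras
of a pair of morphisms between free `T`-algebras on finite sets. -/
def Algebra.IsFP {T : Monad (Type u)} (A : T.Algebra) : Prop :=
  ∃ (X Y : Type u) (_ : Finite X) (_ : Finite Y) (p q : T.free.obj X ⟶ T.free.obj Y)
    (c : T.free.obj Y ⟶ A) (w : p ≫ c = q ≫ c), Nonempty (IsColimit (Cofork.ofπ c w))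

/-- A map `f` between the carriers of `T`-algebras is a `T`-morphism if `a ; f = Tf ; b`. -/
def IsAlgebraMap {T : Monad (Type u)} (A B : T.Algebra) (f : A.A → B.A) : Prop :=
  ∀ t : T.obj A.A, f (A.a t) = B.a (T.map (TypeCat.ofHom f) t)

/-- A set with both a `T`-algebra and a monoid structure. -/
structure Bialgebra (T : Monad (Type u)) where
  alg : T.Algebra
  [monoid : Monoid alg.A]

attribute [instance] Bialgebra.monoid

/-- The underlying `T`-algebra is finitely generated. -/
def Bialgebra.IsFGCarried {T : Monad (Type u)} (M : Bialgebra T) : Prop :=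
  Algebra.IsFG M.alg

/-- A `T`-monoid: a set with a `T`-algebra and a monoid structure whose multiplication is a
`T`-bimorphism. -/
structure TMonoid (T : Monad (Type u)) extends Bialgebra T where
  mul_left_isAlgebraMap : ∀ m : alg.A, IsAlgebraMap alg alg fun x => m * x
  mul_right_isAlgebraMap : ∀ m : alg.A, IsAlgebraMap alg alg fun x => x * m

namespace TMonoid

variable {T : Monad (Type u)}

/-- Morphisms of `T`-monoids: `T`-morphisms that are also monoid morphisms. -/
@[ext]
structure Hom (M N : TMonoid T) where
  algHom : M.alg ⟶ N.alg
  map_one : algHom.f (1 : M.alg.A) = (1 : N.alg.A)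
  map_mul : ∀ x y : M.alg.A, algHom.f (x * y) = algHom.f x * algHom.f y

/-- The category of `T`-monoids. -/
instance : Category (TMonoid T) where
  Hom := Hom
  id M := ⟨𝟙 M.alg, rfl, fun _ _ => rfl⟩
  comp f g := ⟨f.algHom ≫ g.algHom, by simp [f.map_one, g.map_one],
    fun x y => by simp [f.map_mul, g.map_mul]⟩

/-- The underlying map of a morphism of `T`-monoids. -/
def Hom.toFun {M N : TMonoid T} (f : M ⟶ N) : M.alg.A → N.alg.A := f.algHom.f

/-- `F` with `i : X → F` is a free `T`-monoid on the set `X`: every map from `X` to a `T`-monoid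
extends uniquely along `i` to a morphism of `T`-monoids. -/
def IsFreeOn (X : Type u) (F : TMonoid T) (i : X → F.alg.A) : Prop :=
  ∀ (N : TMonoid T) (h : X → N.alg.A), ∃! f : F ⟶ N, ∀ x, Hom.toFun f (i x) = h x

/-- A `T`-monoid is finitely presentable if it is the coequalizer in the category of `T`-monoids
of a pair of morphisms between free `T`-monoids on finite sets. -/
def IsFP (M : TMonoid T) : Prop :=
  ∃ (X Y : Type u) (_ : Finite X) (_ : Finite Y) (FX FY : TMonoid T)
    (iX : X → FX.alg.A) (iY : Y → FY.alg.A) (_ : IsFreeOn X FX iX) (_ : IsFreeOn Y FY iY)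
    (p q : FX ⟶ FY) (c : FY ⟶ M) (w : p ≫ c = q ≫ c), Nonempty (IsColimit (Cofork.ofπ c w))

end TMonoid

end MonadAlg

/-! Take a finite presentation `TX ⇉ TY → M` of the underlying algebra, with quotient map `c`. Since
multiplication is a `T`-bimorphism, it is determined by the products of generators. So as a
`T`-monoid, `M` is presented by the generators `Y` and finitely many relations: the algebra
relations indexed by `X`, one relation `y * z = m (y, z)` with `m (y, z) : TY` for each pair of
generators, and one relation `1 = e` with `e : TY`. Commutativity makes `T` of the free monoid on
`Y` the free `T`-monoid (`isFreeOn_free`). A morphism out of it that respects the relations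
restricts to `TY` and factors through `c` as an algebra morphism, which is multiplicative by
`map_mul_of_generators`. Terms for the products and the unit exist because `c` is surjective
(`surjective_of_isColimit_cofork`). -/

namespace MonadAlg

variable {T : Monad (Type u)}

/-! ### Kleisli calculus for algebras. -/

/-- The algebra morphism from a free algebra extending a map on the generators. -/
def liftHom {X : Type u} (A : T.Algebra) (h : X → A.A) : T.free.obj X ⟶ A where
  f := T.map (TypeCat.ofHom h) ≫ A.a
  h := by
    change T.map (T.map (TypeCat.ofHom h) ≫ A.a) ≫ A.a =
      T.μ.app X ≫ T.map (TypeCat.ofHom h) ≫ A.a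
    rw [T.toFunctor.map_comp, Category.assoc, ← A.assoc]
    exact T.μ.naturality_assoc (TypeCat.ofHom h) A.a

/-- The Kleisli extension of a map into a `T`-algebra. -/
def extend {X : Type u} (A : T.Algebra) (h : X → A.A) (t : T.obj X) : A.A :=
  A.a (T.map (TypeCat.ofHom h) t)

theorem liftHom_apply {X : Type u} (A : T.Algebra) (h : X → A.A) (t : T.obj X) :
    (liftHom A h).f t = extend A h t := rfl

/-- The unit of a monad on sets, as a map. -/
def pureT (T : Monad (Type u)) {X : Type u} (x : X) : T.obj X := T.η.app X x

/-- The Kleisli extension of a map into a free algebra. -/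
def bindT {X Y : Type u} (t : T.obj X) (k : X → T.obj Y) : T.obj Y :=
  extend (T.free.obj Y) k t

theorem extend_pureT {X : Type u} (A : T.Algebra) (h : X → A.A) (x : X) :
    extend A h (pureT T x) = h x := by
  have h1 := ConcreteCategory.congr_hom (T.η.naturality (TypeCat.ofHom h)) x
  have h2 := ConcreteCategory.congr_hom A.unit (h x)
  simp only [Functor.id_map, ConcreteCategory.comp_apply] at h1 h2
  exact (congrArg A.a h1.symm).trans h2

theorem IsAlgebraMap.map_extend {A B : T.Algebra} {f : A.A → B.A} (hf : IsAlgebraMap A B f)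
    {X : Type u} (h : X → A.A) (t : T.obj X) :
    f (extend A h t) = extend B (fun x => f (h x)) t := by
  refine (hf _).trans (congrArg B.a ?_)
  exact (ConcreteCategory.congr_hom
    (T.toFunctor.map_comp (TypeCat.ofHom h) (TypeCat.ofHom f)) t).symm

theorem isAlgebraMap_hom {A B : T.Algebra} (g : A ⟶ B) : IsAlgebraMap A B g.f := by
  intro t
  have := ConcreteCategory.congr_hom g.h t
  exact this.symm

theorem hom_extend {A B : T.Algebra} (g : A ⟶ B) {X : Type u} (h : X → A.A) (t : T.obj X) :
    g.f (extend A h t) = extend B (fun x => g.f (h x)) t :=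
  (isAlgebraMap_hom g).map_extend h t

theorem extend_bindT {X Y : Type u} (A : T.Algebra) (h : Y → A.A) (k : X → T.obj Y)
    (t : T.obj X) :
    extend A h (bindT t k) = extend A (fun x => extend A h (k x)) t := by
  have := hom_extend (liftHom A h) (A := T.free.obj Y) k t
  simp only [liftHom_apply] at this
  exact this

theorem isAlgebraMap_extend {X : Type u} (A : T.Algebra) (h : X → A.A) :
    IsAlgebraMap (T.free.obj X) A (extend A h) := by
  have := isAlgebraMap_hom (liftHom A h)
  simpa only [funext (liftHom_apply A h)] using this

theorem bindT_pureT {X : Type u} (t : T.obj X) : bindT t (pureT T) = t :=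
  ConcreteCategory.congr_hom (T.right_unit X) t

theorem pureT_bindT {X Y : Type u} (x : X) (k : X → T.obj Y) : bindT (pureT T x) k = k x :=
  extend_pureT _ _ _

theorem bindT_assoc {X Y Z : Type u} (t : T.obj X) (k : X → T.obj Y) (l : Y → T.obj Z) :
    bindT (bindT t k) l = bindT t fun x => bindT (k x) l :=
  extend_bindT _ _ _ _

theorem map_eq_bindT {X Y : Type u} (f : X → Y) (t : T.obj X) :
    T.map (TypeCat.ofHom f) t = bindT t fun x => pureT T (f x) := by
  have h1 := T.toFunctor.map_comp (TypeCat.ofHom f) (T.η.app Y)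
  have h2 : bindT t (fun x => pureT T (f x)) =
      T.μ.app Y (T.map (T.η.app Y) (T.map (TypeCat.ofHom f) t)) :=
    congrArg (T.μ.app Y) (ConcreteCategory.congr_hom h1 t)
  rw [h2]
  exact (ConcreteCategory.congr_hom (T.right_unit Y) (T.map (TypeCat.ofHom f) t)).symm

theorem extend_map {X Y : Type u} (A : T.Algebra) (h : Y → A.A) (f : X → Y) (t : T.obj X) :
    extend A h (T.map (TypeCat.ofHom f) t) = extend A (fun x => h (f x)) t := by
  rw [map_eq_bindT, extend_bindT]
  simp only [extend_pureT]

theorem kleisliComp_eq_bindT {X Y Z : Type u} (f : X → T.obj Y) (g : Y → T.obj Z) (x : X) :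
    kleisliComp T f g x = bindT (f x) g := rfl

theorem hom_free_eq_extend {X : Type u} {A : T.Algebra} (g : T.free.obj X ⟶ A) (t : T.obj X) :
    g.f t = extend A (fun x => g.f (pureT T x)) t := by
  conv_lhs => rw [← bindT_pureT t]
  exact hom_extend g _ _

/-- A Fubini rule: the equality of the two double strengths on `(s, t)`, bound with the uncurried
`k`. -/
theorem IsCommutative.bindT_comm (hT : IsCommutative T) {X Y Z : Type u} (s : T.obj X)
    (t : T.obj Y) (k : X → Y → T.obj Z) :
    (bindT s fun x => bindT t fun y => k x y) = bindT t fun y => bindT s fun x => k x y := by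
  have h := congrArg (fun w => bindT w fun p : X × Y => k p.1 p.2) (congrFun (hT X Y) (s, t))
  simpa only [kleisliComp_eq_bindT, leftStrength, rightStrength, map_eq_bindT, bindT_assoc,
    pureT_bindT] using h

/-- An algebra morphism whose underlying map is the given `T`-morphism. -/
def IsAlgebraMap.toHom {A B : T.Algebra} {f : A.A → B.A} (hf : IsAlgebraMap A B f) : A ⟶ B where
  f := TypeCat.ofHom f
  h := by ext t; exact (hf t).symm

/-! ### Surjectivity of coequalizers. -/

/-- A coequalizer map out of a free algebra is surjective on carriers. -/
theorem surjective_of_isColimit_cofork {B A : T.Algebra} {Y : Type u} {p q : B ⟶ T.free.obj Y}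
    {c : T.free.obj Y ⟶ A} {w : p ≫ c = q ≫ c} (hc : IsColimit (Cofork.ofπ c w)) :
    Function.Surjective c.f := by
  -- The image of `c` is a subalgebra through which `c` factors; the universal property then splits
  -- its inclusion into `A`.
  let I : Type u := Set.range (c.f : T.obj Y → A.A)
  have hsec : ∀ z : I, ∃ y : T.obj Y, c.f y = z.1 := fun z => z.2
  choose σ hσ using hsec
  have hmem : ∀ t : T.obj I, extend A (fun z : I => z.1) t ∈ Set.range (c.f : T.obj Y → A.A) := by
    intro t
    refine ⟨bindT t σ, ?_⟩
    refine (hom_extend c σ t).trans ?_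
    simp only [hσ]
  let act : T.obj I → I := fun t => ⟨_, hmem t⟩
  let J : T.Algebra :=
    { A := I
      a := TypeCat.ofHom act
      unit := by
        apply ConcreteCategory.hom_ext
        intro z
        exact Subtype.ext (p := (· ∈ Set.range (c.f : T.obj Y → A.A)))
          (extend_pureT A (fun z : I => z.1) z)
      assoc := by
        apply ConcreteCategory.hom_ext
        intro t
        refine Subtype.ext (p := (· ∈ Set.range (c.f : T.obj Y → A.A))) ?_
        change extend A (fun z : I => z.1) (T.μ.app I t) =
          extend A (fun z : I => z.1) (T.map (TypeCat.ofHom act) t)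
        rw [extend_map]
        have h := extend_bindT A (fun z : I => z.1) (fun x : T.obj I => x) t
        have h' : bindT t (fun x : T.obj I => x) = T.μ.app I t :=
          congrArg (T.μ.app I) (ConcreteCategory.congr_hom (T.toFunctor.map_id (T.obj I)) t)
        rw [h'] at h
        exact h }
  have hi : IsAlgebraMap J A (fun z : I => z.1) := fun t => rfl
  have he : IsAlgebraMap (T.free.obj Y) J (fun y : T.obj Y => (⟨c.f y, y, rfl⟩ : I)) := by
    intro t
    apply Subtype.ext
    exact (isAlgebraMap_hom c t).trans
      (extend_map A (fun z : I => z.1) (fun y : T.obj Y => (⟨c.f y, y, rfl⟩ : I)) t).symm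
  have hei : he.toHom ≫ hi.toHom = c := by ext; rfl
  have hw : p ≫ he.toHom = q ≫ he.toHom := by
    apply Monad.Algebra.Hom.ext
    apply ConcreteCategory.hom_ext
    intro b
    refine Subtype.ext (p := (· ∈ Set.range (c.f : T.obj Y → A.A))) ?_
    exact ConcreteCategory.congr_hom (congrArg Monad.Algebra.Hom.f w) b
  obtain ⟨g, hg⟩ := Cofork.IsColimit.desc' hc he.toHom hw
  have hg : c ≫ g = he.toHom := hg
  have hgi : g ≫ hi.toHom = 𝟙 A := by
    apply Cofork.IsColimit.hom_ext hc
    change c ≫ g ≫ hi.toHom = c ≫ 𝟙 A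
    rw [← Category.assoc, hg, hei, Category.comp_id]
  intro a
  obtain ⟨y, hy⟩ := (g.f a : I).2
  have ha := ConcreteCategory.congr_hom (congrArg Monad.Algebra.Hom.f hgi) a
  exact ⟨y, hy.trans ha⟩

/-! ### Free `T`-monoids. -/

namespace TMonoid

theorem mul_extend (N : TMonoid T) (m : N.alg.A) {X : Type u} (h : X → N.alg.A) (t : T.obj X) :
    m * extend N.alg h t = extend N.alg (fun x => m * h x) t :=
  (N.mul_left_isAlgebraMap m).map_extend h t

theorem extend_mul (N : TMonoid T) (m : N.alg.A) {X : Type u} (h : X → N.alg.A) (t : T.obj X) :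
    extend N.alg h t * m = extend N.alg (fun x => h x * m) t :=
  (N.mul_right_isAlgebraMap m).map_extend h t

theorem bindT_mul_assoc {S : Type u} [Monoid S] (a b c : T.obj S) :
    (bindT (bindT a fun x => bindT b fun y => pureT T (x * y)) fun x =>
        bindT c fun y => pureT T (x * y)) =
      bindT a fun x => bindT (bindT b fun x => bindT c fun y => pureT T (x * y)) fun y =>
        pureT T (x * y) := by
  simp only [bindT_assoc, pureT_bindT, mul_assoc]

theorem bindT_one_mul {S : Type u} [Monoid S] (a : T.obj S) :
    (bindT (pureT T (1 : S)) fun x => bindT a fun y => pureT T (x * y)) = a := by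
  simpa only [pureT_bindT, one_mul] using bindT_pureT a

theorem bindT_mul_one {S : Type u} [Monoid S] (a : T.obj S) :
    (bindT a fun x => bindT (pureT T (1 : S)) fun y => pureT T (x * y)) = a := by
  simpa only [pureT_bindT, mul_one] using bindT_pureT a

/-- The free algebra on a monoid `S`, with the multiplication extended from `S`. -/
def ofMonoid (hT : IsCommutative T) (S : Type u) [Monoid S] : TMonoid T where
  alg := T.free.obj S
  monoid :=
    { mul := fun s t => bindT s fun x => bindT t fun y => pureT T (x * y)
      one := pureT T (1 : S)
      mul_assoc := bindT_mul_assoc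
      one_mul := bindT_one_mul
      mul_one := bindT_mul_one }
  mul_left_isAlgebraMap m := by
    -- The variable `t` sits in the inner bind; commutativity moves it outside, exhibiting the map
    -- as a Kleisli extension. Right multiplication has that form already.
    have h : (fun t : T.obj S => bindT m fun x => bindT t fun y => pureT T (x * y)) =
        extend (T.free.obj S) fun y => bindT m fun x => pureT T (x * y) :=
      funext fun t => hT.bindT_comm _ _ _
    change IsAlgebraMap (T.free.obj S) (T.free.obj S) (fun t : T.obj S => bindT m fun x => bindT t fun y => pureT T (x * y))
    rw [h]
    exact isAlgebraMap_extend _ _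
  mul_right_isAlgebraMap m := isAlgebraMap_extend (T.free.obj S) _

/-- The morphism of `T`-monoids extending a monoid morphism. -/
def ofMonoidLift (hT : IsCommutative T) {S : Type u} [Monoid S] (N : TMonoid T)
    (h : S →* N.alg.A) : ofMonoid hT S ⟶ N where
  algHom := liftHom N.alg h
  map_one := by
    refine (liftHom_apply N.alg h _).trans ((extend_pureT N.alg h 1).trans h.map_one)
  map_mul := fun (s t : T.obj S) => by
    change extend N.alg h (bindT (X := S) s fun x => bindT (X := S) t fun y => pureT T (x * y)) =
      extend N.alg h s * extend N.alg h t
    simp only [extend_bindT, extend_pureT, _root_.map_mul, ← mul_extend, ← extend_mul]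

/-- The free `T`-monoid on a set. -/
def free (hT : IsCommutative T) (X : Type u) : TMonoid T := ofMonoid hT (FreeMonoid X)

/-- The inclusion of the free algebra into the free `T`-monoid. -/
def freeIncl (hT : IsCommutative T) {X : Type u} (t : T.obj X) : (free hT X).alg.A :=
  bindT t fun x => pureT T (FreeMonoid.of x)

/-- The inclusion of the generators into the free `T`-monoid. -/
def freeUnit (hT : IsCommutative T) {X : Type u} (x : X) : (free hT X).alg.A :=
  pureT T (FreeMonoid.of x)

theorem toFun_freeIncl (hT : IsCommutative T) {X : Type u} {N : TMonoid T} (f : free hT X ⟶ N)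
    (t : T.obj X) :
    Hom.toFun f (freeIncl hT t) = extend N.alg (fun x => Hom.toFun f (freeUnit hT x)) t :=
  hom_extend f.algHom (A := T.free.obj (FreeMonoid X)) _ t

theorem hom_ext_toFun {M N : TMonoid T} {f g : M ⟶ N}
    (h : ∀ x, Hom.toFun f x = Hom.toFun g x) : f = g := by
  apply Hom.ext
  ext x
  exact h x

theorem isFreeOn_free (hT : IsCommutative T) (X : Type u) :
    IsFreeOn X (free hT X) (freeUnit hT) := by
  intro N h
  refine ⟨ofMonoidLift hT N (FreeMonoid.lift h), fun x => ?_, fun g hg => ?_⟩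
  · refine (liftHom_apply N.alg (FreeMonoid.lift h) _).trans ?_
    refine (extend_pureT N.alg (FreeMonoid.lift h) _).trans ?_
    simp
  · apply hom_ext_toFun
    intro t
    refine (hom_free_eq_extend (X := FreeMonoid X) g.algHom t).trans ?_
    refine Eq.trans ?_ (liftHom_apply N.alg (FreeMonoid.lift h) t).symm
    -- On pure words `g` is a monoid morphism, hence determined by the letters.
    have key : (fun l : FreeMonoid X => g.algHom.f (pureT T l)) = FreeMonoid.lift h := by
      let φ : FreeMonoid X →* N.alg.A :=
        { toFun := fun l => g.algHom.f (pureT T l)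
          map_one' := g.map_one
          map_mul' := fun a b => by
            refine Eq.trans ?_ (g.map_mul (pureT T a) (pureT T b))
            refine congrArg g.algHom.f ?_
            change _ = bindT (pureT T a) fun x => bindT (pureT T b) fun y => pureT T (x * y)
            simp only [pureT_bindT] }
      have : φ = FreeMonoid.lift h := by
        apply FreeMonoid.hom_eq
        intro x
        exact (hg x).trans (by simp)
      exact congrArg DFunLike.coe this
    exact congrArg (fun k => extend N.alg k t) key

/-- The morphism out of the free `T`-monoid extending a map on the generators. -/
def freeLift (hT : IsCommutative T) {X : Type u} (N : TMonoid T) (h : X → N.alg.A) :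
    free hT X ⟶ N :=
  ofMonoidLift hT N (FreeMonoid.lift h)

theorem freeLift_freeUnit (hT : IsCommutative T) {X : Type u} (N : TMonoid T) (h : X → N.alg.A)
    (x : X) : Hom.toFun (freeLift hT N h) (freeUnit hT x) = h x :=
  (liftHom_apply N.alg (FreeMonoid.lift h) _).trans
    ((extend_pureT N.alg (FreeMonoid.lift h) _).trans (by simp))

theorem free_hom_ext (hT : IsCommutative T) {X : Type u} {N : TMonoid T} {f g : free hT X ⟶ N}
    (h : ∀ x, Hom.toFun f (freeUnit hT x) = Hom.toFun g (freeUnit hT x)) : f = g :=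
  (isFreeOn_free hT X N fun x => Hom.toFun g (freeUnit hT x)).unique h fun _ => rfl

theorem toFun_comp {L M N : TMonoid T} (f : L ⟶ M) (g : M ⟶ N) (x : L.alg.A) :
    Hom.toFun (f ≫ g) x = Hom.toFun g (Hom.toFun f x) := rfl

theorem toFun_mul {M N : TMonoid T} (f : M ⟶ N) (x y : M.alg.A) :
    Hom.toFun f (x * y) = Hom.toFun f x * Hom.toFun f y := Hom.map_mul f x y

theorem toFun_one {M N : TMonoid T} (f : M ⟶ N) :
    Hom.toFun f 1 = 1 := Hom.map_one f

/-! ### From algebra presentations to `T`-monoid presentations. -/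

/-- An algebra morphism between `T`-monoids is multiplicative as soon as it is so on a set of
algebra generators. -/
theorem map_mul_of_generators {M N : TMonoid T} (g : M.alg ⟶ N.alg) {Y : Type u}
    (h : Y → M.alg.A) (hh : Function.Surjective (extend M.alg h))
    (hmul : ∀ y z, g.f (h y * h z) = g.f (h y) * g.f (h z)) (a b : M.alg.A) :
    g.f (a * b) = g.f a * g.f b := by
  obtain ⟨s, rfl⟩ := hh a
  obtain ⟨t, rfl⟩ := hh b
  -- Both sides become the same iterated extension over pairs of generators.
  simp only [mul_extend, extend_mul, hom_extend, hmul]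

/-- If the underlying algebra of a `T`-monoid is finitely presentable then so is the
`T`-monoid. -/
theorem isFP_of_alg_isFP (hT : IsCommutative T) (M : TMonoid T) (hM : Algebra.IsFP M.alg) :
    M.IsFP := by
  obtain ⟨X, Y, hX, hY, p, q, c, w, ⟨hc⟩⟩ := hM
  have hsurj := surjective_of_isColimit_cofork hc
  let u : Y → M.alg.A := fun y => c.f (pureT T y)
  have hcu : ∀ t : T.obj Y, c.f t = extend M.alg u t := hom_free_eq_extend c
  have hu : Function.Surjective (extend M.alg u) := fun a => by
    obtain ⟨t, ht⟩ := hsurj a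
    exact ⟨t, (hcu t).symm.trans ht⟩
  -- Terms in `TY` representing the products of generators; `e` below represents the unit.
  choose m hm using fun yz : Y × Y => hu (u yz.1 * u yz.2)
  obtain ⟨e, he⟩ := hu 1
  have hpq : ∀ {A : T.Algebra} (g : T.free.obj Y ⟶ A),
      (∀ x, g.f (p.f (pureT T x)) = g.f (q.f (pureT T x))) → p ≫ g = q ≫ g := by
    intro A g h
    ext t
    refine (hom_free_eq_extend (p ≫ g) t).trans
      (Eq.trans ?_ (hom_free_eq_extend (q ≫ g) t).symm)
    exact congrArg (fun k => extend A k t) (funext h)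
  have hw : ∀ t : T.obj X, c.f (p.f t) = c.f (q.f t) := fun t =>
    ConcreteCategory.congr_hom (congrArg Monad.Algebra.Hom.f w) t
  -- The summands index the algebra, product and unit relations.
  let lhs : X ⊕ (Y × Y) ⊕ PUnit.{u + 1} → (free hT Y).alg.A :=
    Sum.elim (fun x => freeIncl hT (p.f (pureT T x)))
      (Sum.elim (fun yz => freeUnit hT yz.1 * freeUnit hT yz.2) fun _ => 1)
  let rhs : X ⊕ (Y × Y) ⊕ PUnit.{u + 1} → (free hT Y).alg.A :=
    Sum.elim (fun x => freeIncl hT (q.f (pureT T x)))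
      (Sum.elim (fun yz => freeIncl hT (m yz)) fun _ => freeIncl hT e)
  let P := freeLift hT (free hT Y) lhs
  let Q := freeLift hT (free hT Y) rhs
  let C := freeLift hT M u
  have hCi : ∀ t : T.obj Y, Hom.toFun C (freeIncl hT t) = c.f t := fun t => by
    rw [toFun_freeIncl, hcu]
    simp only [C, freeLift_freeUnit]
  have W : P ≫ C = Q ≫ C := by
    apply free_hom_ext
    intro r
    simp only [toFun_comp, P, Q, freeLift_freeUnit]
    rcases r with x | yz | _
    · exact (hCi _).trans ((hw _).trans (hCi _).symm)
    · refine (toFun_mul C _ _).trans (Eq.trans ?_ (hCi (m yz)).symm)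
      simp only [C, freeLift_freeUnit, hcu, hm]
    · exact (toFun_one C).trans (Eq.trans (he.symm.trans (hcu e).symm) (hCi e).symm)
  refine ⟨X ⊕ (Y × Y) ⊕ PUnit.{u + 1}, Y, inferInstance, hY, free hT _, free hT Y, freeUnit hT,
    freeUnit hT, isFreeOn_free hT _, isFreeOn_free hT Y, P, Q, C, W, ⟨?_⟩⟩
  have main : ∀ {N : TMonoid T} (F : free hT Y ⟶ N), P ≫ F = Q ≫ F → ∃ g : M ⟶ N, C ≫ g = F := by
    intro N F hF
    have hrel : ∀ r, Hom.toFun F (lhs r) = Hom.toFun F (rhs r) := fun r => by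
      have := congrArg (fun k => Hom.toFun k (freeUnit hT r)) hF
      simpa only [toFun_comp, P, Q, freeLift_freeUnit] using this
    let v : Y → N.alg.A := fun y => Hom.toFun F (freeUnit hT y)
    have hFi : ∀ t, Hom.toFun F (freeIncl hT t) = extend N.alg v t := toFun_freeIncl hT F
    -- The restriction of `F` to `TY` coequalizes `p` and `q`, by the relations from `X`.
    have h1 : p ≫ liftHom N.alg v = q ≫ liftHom N.alg v := hpq _ fun x => by
      refine (liftHom_apply N.alg v _).trans (Eq.trans ?_ (liftHom_apply N.alg v _).symm)
      exact (hFi _).symm.trans ((hrel (Sum.inl x)).trans (hFi _))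
    obtain ⟨g, hg⟩ := Cofork.IsColimit.desc' hc _ h1
    have hgt : ∀ t : T.obj Y, g.f (c.f t) = extend N.alg v t := fun t =>
      (ConcreteCategory.congr_hom (congrArg Monad.Algebra.Hom.f hg) t).trans
        (liftHom_apply N.alg v t)
    have hgu : ∀ y, g.f (u y) = v y := fun y => (hgt _).trans (extend_pureT N.alg v y)
    refine ⟨⟨g, ?_, map_mul_of_generators g u hu fun y z => ?_⟩, ?_⟩
    · rw [← he, ← hcu, hgt, ← hFi, ← toFun_one F]
      exact (hrel (Sum.inr (Sum.inr PUnit.unit))).symm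
    · rw [← hm (y, z), ← hcu, hgt, ← hFi, hgu, hgu]
      exact (hrel (Sum.inr (Sum.inl (y, z)))).symm.trans (toFun_mul F _ _)
    · apply free_hom_ext
      intro y
      rw [toFun_comp]
      simp only [C, freeLift_freeUnit]
      exact hgu y
  -- `C` is epi because it restricts on `TY` to the surjection `c`.
  have hepi : ∀ {N : TMonoid T} (f g : M ⟶ N), C ≫ f = C ≫ g → f = g := by
    intro N f g h
    apply hom_ext_toFun
    intro a
    obtain ⟨t, rfl⟩ := hsurj a
    have ht := congrArg (fun k => Hom.toFun k (freeIncl hT t)) h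
    simp only [toFun_comp] at ht
    exact (congrArg (Hom.toFun f) (hCi t)).symm.trans (ht.trans (congrArg (Hom.toFun g) (hCi t)))
  exact Cofork.IsColimit.mk _ (fun s => (main s.π s.condition).choose)
    (fun s => (main s.π s.condition).choose_spec)
    fun s k hk => hepi _ _ (hk.trans (main s.π s.condition).choose_spec.symm)

end TMonoid

end MonadAlg

theorem mainTheorem7 (T : CategoryTheory.Monad (Type u))
    (hfin : MonadAlg.IsFinitary T) (hcomm : MonadAlg.IsCommutative T)
    (hfgfp : ∀ A : T.Algebra, MonadAlg.Algebra.IsFG A → MonadAlg.Algebra.IsFP A)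
    (M : MonadAlg.TMonoid T) (hM : M.IsFGCarried) :
    M.IsFP :=
  M.isFP_of_alg_isFP hcomm (hfgfp M.alg hM)
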